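/- Let $G$ be a compact group with normalized Haar measure, and let $n\ge 2$ be an integer. All linear spaces are complex. Let $\widehat G$ be the set of unitary equivalence classes of irreducible (strongly continuous) unitary representations $\pi$ of $G$ on Hilbert spaces $H_\pi$; these spaces are finite-dimensional, and we write $d_\pi=\dim H_\pi$ and $\chi_\pi(t)=\operatorname{trace}\pi(t)$. Let $\mathcal T(G)\subset C(G)$ be the linear span of all functions $t\mapsto\langle \pi(t)u\,|\,v\rangle$ with $[\pi]\in\widehat G$ and $u,v\in H_\pi$ (the trigonometric polynomials on $G$). It is an algebra under the convolution $(f*g)(t)=\int_G f(s)g(s^{-1}t)\,ds$; write $f^{*n}$ for the $n$-fold convolution product $f*\cdots*f$. Let $X$ be a linear space and let $P\colon\mathcal T(G)\to X$ be an $n$-homogeneous polynomial, i.e. $P(f)=\psi(f,\dots,f)$ for some $n$-linear map $\psi\colon\mathcal T(G)^n\to X$. Suppose that $P$ is orthogonally additive, i.e. $P(f+g)=P(f)+P(g)$ whenever $f,g\in\mathcal T(G)$ satisfy $f*g=g*f=0$. Then there exists a unique linear map $\Phi\colon\mathcal T(G)\to X$ such that $$P(f)=\Phi\left(f^{*n}\right)\qquad(f\in\mathcal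 T(G)).$$ Further, let $\varphi\colon\mathcal T(G)^n\to X$ be the symmetric $n$-linear map associated with $P$, i.e. the unique symmetric $n$-linear map with $P(f)=\varphi(f,\dots,f)$ for all $f$. Then, for each $f\in\mathcal T(G)$, one has $f*\chi_\pi=0$ for all but finitely many $[\pi]\in\widehat G$, and $$\Phi(f)=\sum_{[\pi]\in\widehat G}\varphi\left(d_\pi f*\chi_\pi,\,d_\pi\chi_\pi,\dots,d_\pi\chi_\pi\right).$$ -/

import Mathlib

open MeasureTheory TopologicalSpace

universe u v

namespace TrigPolynomials

/-! ### Irreducible unitary representations -/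

/-- An irreducible unitary representation of the topological group `G`: a strongly continuous
homomorphism into the unitary group of a nonzero complex Hilbert space, with no closed invariant
subspaces but the two trivial ones.  (No finite-dimensionality is assumed.) -/
structure IrredUnitaryRep (G : Type u) [Group G] [TopologicalSpace G] : Type (u + 1) where
  H : Type u
  [instNorm : NormedAddCommGroup H]
  [instInner : InnerProductSpace ℂ H]
  [instComplete : CompleteSpace H]
  [instNontrivial : Nontrivial H]
  toHom : G →* (H ≃ₗᵢ[ℂ] H)
  strongly_continuous : ∀ x : H, Continuous fun t : G => toHom t x
  irreducible : ∀ W : Submodule ℂ H, IsClosed (W : Set H) →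
    (∀ t : G, ∀ w ∈ W, toHom t w ∈ W) → W = ⊥ ∨ W = ⊤

attribute [instance] IrredUnitaryRep.instNorm IrredUnitaryRep.instInner
  IrredUnitaryRep.instComplete IrredUnitaryRep.instNontrivial

section Reps

variable {G : Type u} [Group G] [TopologicalSpace G]

/-- Unitary equivalence of irreducible unitary representations. -/
instance unitaryEquivalence (G : Type u) [Group G] [TopologicalSpace G] :
    Setoid (IrredUnitaryRep G) where
  r π ρ := ∃ U : π.H ≃ₗᵢ[ℂ] ρ.H, ∀ (t : G) (x : π.H), U (π.toHom t x) = ρ.toHom t (U x)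
  iseqv :=
    { refl := fun π => ⟨LinearIsometryEquiv.refl ℂ π.H, fun _ _ => rfl⟩
      symm := by
        rintro π ρ ⟨U, hU⟩
        refine ⟨U.symm, fun t x => ?_⟩
        apply U.injective
        simp [hU]
      trans := by
        rintro π ρ σ ⟨U, hU⟩ ⟨V, hV⟩
        exact ⟨U.trans V, fun t x => by simp [hU, hV]⟩ }

/-- `Ĝ`: the set of equivalence classes of irreducible unitary representations of `G`. -/
def UnitaryDual (G : Type u) [Group G] [TopologicalSpace G] : Type (u + 1) :=
  Quotient (unitaryEquivalence G)

/-- The function `t ↦ ⟨π(t) x | y⟩`, with `⟨· | ·⟩` linear in its first variable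
(Mathlib's inner product is linear in its second variable). -/
noncomputable def coefficient (π : IrredUnitaryRep G) (x y : π.H) : C(G, ℂ) where
  toFun t := inner ℂ y (π.toHom t x)
  continuous_toFun := continuous_const.inner (π.strongly_continuous x)

/-- `𝒯_π(G)`: the linear span of the coefficients of `π`. -/
noncomputable def coefficientSpace (π : IrredUnitaryRep G) : Submodule ℂ C(G, ℂ) :=
  Submodule.span ℂ {f | ∃ x y : π.H, f = coefficient π x y}

variable (G) in
/-- `𝒯(G)`: the space of trigonometric polynomials on `G`, the linear span of all the
spaces `𝒯_π(G)`. -/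
noncomputable def TrigPoly : Submodule ℂ C(G, ℂ) :=
  ⨆ π : IrredUnitaryRep G, coefficientSpace π

theorem coefficient_mem (π : IrredUnitaryRep G) (x y : π.H) : coefficient π x y ∈ TrigPoly G :=
  Submodule.mem_iSup_of_mem π (Submodule.subset_span ⟨x, y, rfl⟩)

/-- The dimension of `π` (it is finite when `G` is compact). -/
noncomputable def dim (π : IrredUnitaryRep G) : ℕ := Module.finrank ℂ π.H

/-- The values `χ_π(t) = trace (π(t))` of the character of `π`. -/
noncomputable def charFun (π : IrredUnitaryRep G) (t : G) : ℂ :=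
  LinearMap.trace ℂ π.H (π.toHom t).toLinearEquiv.toLinearMap

theorem exists_charFun (π : IrredUnitaryRep G) : ∃ f ∈ TrigPoly G, ⇑f = charFun π := by
  by_cases h : FiniteDimensional ℂ π.H
  · let b := stdOrthonormalBasis ℂ π.H
    refine ⟨∑ i, coefficient π (b i) (b i),
      Submodule.sum_mem _ fun i _ => coefficient_mem π _ _, ?_⟩
    funext t
    simp [charFun, LinearMap.trace_eq_sum_inner _ b, coefficient]
  · refine ⟨0, Submodule.zero_mem _, ?_⟩
    funext t
    have h' : ¬ ∃ s : Finset π.H, Nonempty (Module.Basis s ℂ π.H) := by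
      rintro ⟨s, ⟨b⟩⟩
      exact h (Module.Finite.of_basis b)
    simp [charFun, LinearMap.trace, h']

/-- The character `χ_π`, as an element of `𝒯(G)`. -/
noncomputable def character (π : IrredUnitaryRep G) : TrigPoly G :=
  ⟨⟨charFun π, by obtain ⟨f, -, h⟩ := exists_charFun π; rw [← h]; exact f.continuous⟩, by
    obtain ⟨f, hf, h⟩ := exists_charFun π
    convert hf
    ext t
    exact (congrFun h t).symm⟩

theorem dim_eq_of_equiv (π ρ : IrredUnitaryRep G) (h : unitaryEquivalence G π ρ) :
    dim π = dim ρ := by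
  obtain ⟨U, -⟩ := h
  exact U.toLinearEquiv.finrank_eq

theorem character_eq_of_equiv (π ρ : IrredUnitaryRep G) (h : unitaryEquivalence G π ρ) :
    character π = character ρ := by
  obtain ⟨U, hU⟩ := h
  apply Subtype.ext
  ext t
  change charFun π t = charFun ρ t
  unfold charFun
  rw [← LinearMap.trace_conj' _ U.toLinearEquiv]
  congr 1
  ext x
  simp [LinearEquiv.conj_apply, hU]

/-- `d_π` for a class `[π] ∈ Ĝ`. -/
noncomputable def UnitaryDual.dim (p : UnitaryDual G) : ℕ :=
  Quotient.lift TrigPolynomials.dim dim_eq_of_equiv p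

/-- `χ_π` for a class `[π] ∈ Ĝ`. -/
noncomputable def UnitaryDual.character (p : UnitaryDual G) : TrigPoly G :=
  Quotient.lift TrigPolynomials.character character_eq_of_equiv p

end Reps

/-! ### Convolution -/

section Convolution

variable {G : Type u} [Group G] [TopologicalSpace G] [IsTopologicalGroup G] [CompactSpace G]
  [MeasurableSpace G] [BorelSpace G]

variable (G) in
/-- The normalized Haar measure of the compact group `G`. -/
noncomputable def haar : Measure G := Measure.haarMeasure (⊤ : PositiveCompacts G)

instance : (haar G).IsHaarMeasure := by unfold haar; infer_instance

instance : IsProbabilityMeasure (haar G) :=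
  ⟨by simpa [haar] using Measure.haarMeasure_self (K₀ := (⊤ : PositiveCompacts G))⟩

theorem integrable_of_continuous {E : Type*} [NormedAddCommGroup E] {f : G → E}
    (hf : Continuous f) : Integrable f (haar G) :=
  hf.integrable_of_hasCompactSupport (HasCompactSupport.of_compactSpace f)

/-- The convolution `(f ∗ g)(t) = ∫ f(s) g(s⁻¹ t) ds` of continuous functions. -/
noncomputable def convFun (f g : C(G, ℂ)) (t : G) : ℂ := ∫ s, f s * g (s⁻¹ * t) ∂(haar G)

theorem convFun_add (f g h : C(G, ℂ)) : convFun f (g + h) = convFun f g + convFun f h := by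
  funext t
  simp only [convFun, Pi.add_apply, ContinuousMap.add_apply, mul_add]
  exact integral_add (integrable_of_continuous (by fun_prop))
    (integrable_of_continuous (by fun_prop))

theorem convFun_smul (f : C(G, ℂ)) (c : ℂ) (g : C(G, ℂ)) :
    convFun f (c • g) = c • convFun f g := by
  funext t
  simp only [convFun, Pi.smul_apply, ContinuousMap.smul_apply, smul_eq_mul]
  rw [← integral_const_mul]
  congr 1
  funext s
  ring

theorem convFun_coefficient (f : C(G, ℂ)) (π : IrredUnitaryRep G) (x y : π.H) :
    convFun f (coefficient π x y) =
      coefficient π x (∫ s, (starRingEnd ℂ) (f s) • π.toHom s y ∂(haar G)) := by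
  funext t
  have hc : Continuous fun s : G => (starRingEnd ℂ) (f s) • π.toHom s y :=
    (RCLike.continuous_conj.comp f.continuous).smul (π.strongly_continuous y)
  have hi := integrable_of_continuous hc
  change ∫ s, f s * inner ℂ y (π.toHom (s⁻¹ * t) x) ∂(haar G) = inner ℂ _ (π.toHom t x)
  rw [← inner_conj_symm, ← integral_inner hi, ← integral_conj]
  congr 1
  funext s
  rw [inner_conj_symm, inner_smul_left, RingHomCompTriple.comp_apply, RingHom.id_apply]
  congr 1
  have h : π.toHom t x = π.toHom s (π.toHom (s⁻¹ * t) x) := by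
    conv_lhs => rw [← mul_inv_cancel_left s t, map_mul]
    rfl
  rw [h, LinearIsometryEquiv.inner_map_map]

theorem exists_convFun (f : C(G, ℂ)) {g : C(G, ℂ)} (hg : g ∈ TrigPoly G) :
    ∃ h ∈ TrigPoly G, ⇑h = convFun f g := by
  have hle : ∀ g ∈ TrigPoly G, ∃ h ∈ TrigPoly G, ⇑h = convFun f g := by
    intro g hg
    unfold TrigPoly at hg
    induction hg using Submodule.iSup_induction' with
    | mem π g hg =>
      unfold coefficientSpace at hg
      induction hg using Submodule.span_induction with
      | mem g hg =>
        obtain ⟨x, y, rfl⟩ := hg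
        exact ⟨_, coefficient_mem π _ _, (convFun_coefficient f π x y).symm⟩
      | zero => exact ⟨0, Submodule.zero_mem _, by funext t; simp [convFun]⟩
      | add g₁ g₂ _ _ h₁ h₂ =>
        obtain ⟨a, ha, ha'⟩ := h₁
        obtain ⟨b, hb, hb'⟩ := h₂
        exact ⟨a + b, Submodule.add_mem _ ha hb, by
          rw [convFun_add, ← ha', ← hb', ContinuousMap.coe_add]⟩
      | smul c g _ h =>
        obtain ⟨a, ha, ha'⟩ := h
        exact ⟨c • a, Submodule.smul_mem _ c ha, by
          rw [convFun_smul, ← ha', ContinuousMap.coe_smul]⟩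
    | zero => exact ⟨0, Submodule.zero_mem _, by funext t; simp [convFun]⟩
    | add g₁ g₂ _ _ h₁ h₂ =>
      obtain ⟨a, ha, ha'⟩ := h₁
      obtain ⟨b, hb, hb'⟩ := h₂
      exact ⟨a + b, Submodule.add_mem _ ha hb, by
        rw [convFun_add, ← ha', ← hb', ContinuousMap.coe_add]⟩
  exact hle g hg

/-- The convolution product of the algebra `𝒯(G)`. -/
noncomputable def conv (f g : TrigPoly G) : TrigPoly G :=
  ⟨⟨convFun f.1 g.1, by
      obtain ⟨h, -, e⟩ := exists_convFun f.1 g.2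
      rw [← e]; exact h.continuous⟩, by
    obtain ⟨h, hh, e⟩ := exists_convFun f.1 g.2
    convert hh
    ext t
    exact (congrFun e t).symm⟩

theorem conv_apply (f g : TrigPoly G) (t : G) :
    (conv f g).1 t = ∫ s, f.1 s * g.1 (s⁻¹ * t) ∂(haar G) := rfl

/-- The `n`-fold convolution product `f^{∗n} = f ∗ ⋯ ∗ f`, for `n ≥ 1`
(the value at `n = 0` is a dummy). -/
noncomputable def convPow (f : TrigPoly G) : ℕ → TrigPoly G
  | 0 => 0
  | 1 => f
  | n + 2 => conv (convPow f (n + 1)) f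

/-- Orthogonal additivity of a map on the convolution algebra `𝒯(G)`. -/
def IsOrthogonallyAdditive {X : Type v} [AddCommGroup X] (P : TrigPoly G → X) : Prop :=
  ∀ f g : TrigPoly G, conv f g = 0 → conv g f = 0 → P (f + g) = P f + P g

end Convolution

/-! ### Homogeneous polynomials -/

section Polynomials

variable {E : Type u} {X : Type v} [AddCommGroup E] [Module ℂ E] [AddCommGroup X] [Module ℂ X]

/-- `P` is an `n`-homogeneous polynomial: the diagonal of some `n`-linear map. -/
def IsHomogeneousPolynomial (n : ℕ) (P : E → X) : Prop :=
  ∃ φ : MultilinearMap ℂ (fun _ : Fin n => E) X, ∀ x, P x = φ fun _ => x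

/-- `φ` is the symmetric `n`-linear map associated with the `n`-homogeneous polynomial `P`. -/
def IsAssociatedSymmetric {n : ℕ} (φ : MultilinearMap ℂ (fun _ : Fin n => E) X) (P : E → X) :
    Prop :=
  (∀ (σ : Equiv.Perm (Fin n)) (x : Fin n → E), φ (fun i => x (σ i)) = φ x) ∧
    ∀ x, P x = φ fun _ => x

end Polynomials

end TrigPolynomials

/-! By Schur orthogonality, `𝒯(G)` under convolution is a direct sum of full matrix algebras, one
for each class in `Ĝ`, with `d_π χ_π` the identity of its block. Call an element Hermitian if it
comes from Hermitian operators in finitely many blocks. The spectral theorem writes it as `f = ∑ l_j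
e_j`, where the `e_j` are mutually orthogonal minimal projections. Orthogonal additivity and
homogeneity give `P(f) = ∑ l_j^n P(e_j)`, while `f^{∗n} = ∑ l_j^n e_j`. Hence a linear `Φ` that
agrees with `P` on minimal projections satisfies the identity at every Hermitian `f`.

The sum in the statement defines such a `Φ`. If `e` is a minimal projection in the block of `π`,
then `e` and `b = d_π χ_π - e` are orthogonal, so `P(e + b + t e) = (1 + t)^n P(e) + P(b)`.
Comparing coefficients of `t` gives `φ(e, d_π χ_π, …, d_π χ_π) = P(e)`
(`IsOrthogonallyAdditive.update_add`, `representingMap_vectorProj`).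

A general `f` is `a + i b` with `a`, `b` Hermitian. The polynomial `t ↦ P(a + t b) - Φ((a + t
b)^{∗n})` vanishes for real `t`, hence at `t = i` (`eq_representingMap_convPow`). Uniqueness holds
because minimal projections are idempotent and span `𝒯(G)`.

Representations are not assumed finite-dimensional, so Schur's lemma is first proved for
self-adjoint operators by functional calculus, and finite-dimensionality is deduced from it. -/

namespace TrigPolynomials

/-! ### Vector-valued polynomials in one variable, and polarization. -/

section PolynomialCurves

variable {V W Z : Type*} [AddCommGroup V] [Module ℂ V] [AddCommGroup W] [Module ℂ W]
  [AddCommGroup Z] [Module ℂ Z]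

variable (V) in
/-- The polynomial functions of a complex variable with values in `V`. -/
def polyCurve : Submodule ℂ (ℂ → V) :=
  Submodule.span ℂ {c | ∃ (k : ℕ) (v : V), c = fun t => t ^ k • v}

theorem monomial_mem_polyCurve (k : ℕ) (v : V) : (fun t : ℂ => t ^ k • v) ∈ polyCurve V :=
  Submodule.subset_span ⟨k, v, rfl⟩

theorem affine_mem_polyCurve (a b : V) : (fun t : ℂ => a + t • b) ∈ polyCurve V := by
  simpa [Pi.add_def] using
    (polyCurve V).add_mem (monomial_mem_polyCurve 0 a) (monomial_mem_polyCurve 1 b)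

theorem map_mem_polyCurve (L : V →ₗ[ℂ] W) {c : ℂ → V} (hc : c ∈ polyCurve V) :
    (fun t => L (c t)) ∈ polyCurve W := by
  unfold polyCurve at hc
  induction hc using Submodule.span_induction with
  | mem c h =>
    obtain ⟨k, v, rfl⟩ := h
    simpa using monomial_mem_polyCurve k (L v)
  | zero => simp only [Pi.zero_apply, map_zero]; exact (polyCurve W).zero_mem
  | add c d _ _ hc hd => simpa [Pi.add_def] using (polyCurve W).add_mem hc hd
  | smul r c _ hc => simpa [Pi.smul_def] using (polyCurve W).smul_mem r hc

theorem map₂_mem_polyCurve (L : V →ₗ[ℂ] W →ₗ[ℂ] Z) {c : ℂ → V} {d : ℂ → W}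
    (hc : c ∈ polyCurve V) (hd : d ∈ polyCurve W) :
    (fun t => L (c t) (d t)) ∈ polyCurve Z := by
  unfold polyCurve at hc
  induction hc using Submodule.span_induction with
  | mem c h =>
    obtain ⟨k, v, rfl⟩ := h
    unfold polyCurve at hd
    induction hd using Submodule.span_induction with
    | mem d h =>
      obtain ⟨l, w, rfl⟩ := h
      simpa [smul_smul, ← pow_add, add_comm] using monomial_mem_polyCurve (k + l) (L v w)
    | zero => simp only [Pi.zero_apply, map_zero]; exact (polyCurve Z).zero_mem
    | add c d _ _ hc hd => simpa [Pi.add_def] using (polyCurve Z).add_mem hc hd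
    | smul r c _ hc =>
      simpa [Pi.smul_def, smul_comm r] using (polyCurve Z).smul_mem r hc
  | zero => simp only [Pi.zero_apply, map_zero, LinearMap.zero_apply]; exact (polyCurve Z).zero_mem
  | add c d _ _ hc hd => simpa [Pi.add_def] using (polyCurve Z).add_mem hc hd
  | smul r c _ hc => simpa [Pi.smul_def] using (polyCurve Z).smul_mem r hc

theorem exists_eval_of_mem_polyCurve {c : ℂ → ℂ} (hc : c ∈ polyCurve ℂ) :
    ∃ p : Polynomial ℂ, ∀ t, c t = p.eval t := by
  unfold polyCurve at hc
  induction hc using Submodule.span_induction with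
  | mem c h =>
    obtain ⟨k, v, rfl⟩ := h
    exact ⟨Polynomial.X ^ k * Polynomial.C v, fun t => by
      rw [Polynomial.eval_mul, Polynomial.eval_pow, Polynomial.eval_X, Polynomial.eval_C]
      rfl⟩
  | zero => exact ⟨0, by simp⟩
  | add c d _ _ hc hd =>
    obtain ⟨p, hp⟩ := hc
    obtain ⟨q, hq⟩ := hd
    exact ⟨p + q, by simp [hp, hq]⟩
  | smul r c _ hc =>
    obtain ⟨p, hp⟩ := hc
    exact ⟨Polynomial.C r * p, by simp [hp]⟩

/-- Linear functionals separate the points of `V`, which reduces the claim to a scalar polynomial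
with infinitely many roots. No topology on `V` is needed. -/
theorem polyCurve_eq_zero_of_real {c : ℂ → V} (hc : c ∈ polyCurve V)
    (h : ∀ t : ℝ, c t = 0) (t : ℂ) : c t = 0 := by
  rw [← Module.forall_dual_apply_eq_zero_iff ℂ]
  intro l
  obtain ⟨p, hp⟩ := exists_eval_of_mem_polyCurve (map_mem_polyCurve l hc)
  have hp0 : p = 0 := by
    refine Polynomial.eq_zero_of_infinite_isRoot p
      ((Set.infinite_range_of_injective Complex.ofReal_injective).mono ?_)
    rintro _ ⟨s, rfl⟩
    change p.eval _ = 0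
    rw [← hp, h, map_zero]
  rw [hp, hp0, Polynomial.eval_zero]

variable {n : ℕ}

theorem diagonal_add_smul (φ : MultilinearMap ℂ (fun _ : Fin n => V) W) (a c : V) (t : ℂ) :
    φ (fun _ => c + t • a) = ∑ s : Finset (Fin n),
      t ^ s.card • φ (s.piecewise (fun _ => a) fun _ => c) := by
  have h := φ.map_add_univ (fun _ => t • a) (fun _ => c)
  have e : (fun _ : Fin n => c + t • a) = (fun _ => t • a) + fun _ => c := by
    funext; simp [add_comm]
  rw [e, h]
  refine Finset.sum_congr rfl fun s _ => ?_
  have h2 := φ.map_piecewise_smul (fun _ => t) (s.piecewise (fun _ => a) fun _ => c) s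
  rw [Finset.prod_const] at h2
  rw [← h2]
  congr 1
  funext i
  by_cases hi : i ∈ s <;> simp [hi]

theorem diagonal_mem_polyCurve (φ : MultilinearMap ℂ (fun _ : Fin n => V) W) (a c : V) :
    (fun t : ℂ => φ fun _ => c + t • a) ∈ polyCurve W := by
  have e : (fun t : ℂ => φ fun _ => c + t • a) = ∑ s : Finset (Fin n),
      fun t : ℂ => t ^ s.card • φ (s.piecewise (fun _ => a) fun _ => c) := by
    funext t
    rw [diagonal_add_smul, Finset.sum_apply]
  rw [e]
  exact Submodule.sum_mem _ fun s _ => monomial_mem_polyCurve _ _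

/-- The derivative at `0` of a homogeneous polynomial along a line, read off from any other
polynomial expression `(1 + t) ^ n • x + y` of its restriction to the line. -/
theorem sum_update_eq_of_diagonal (φ : MultilinearMap ℂ (fun _ : Fin n => V) W) (a c : V)
    (x y : W) (h : ∀ t : ℂ, φ (fun _ => c + t • a) = (1 + t) ^ n • x + y) :
    ∑ i, φ (Function.update (fun _ => c) i a) = (n : ℂ) • x := by
  rw [← sub_eq_zero, ← Module.forall_dual_apply_eq_zero_iff ℂ]
  intro l
  rw [map_sub, sub_eq_zero]
  let p : Polynomial ℂ := ∑ s : Finset (Fin n),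
      Polynomial.monomial s.card (l (φ (s.piecewise (fun _ => a) fun _ => c)))
  let q : Polynomial ℂ := (1 + Polynomial.X) ^ n * Polynomial.C (l x) + Polynomial.C (l y)
  have hpq : p = q := by
    refine Polynomial.funext fun t => ?_
    have := congrArg l (h t)
    rw [diagonal_add_smul] at this
    simpa [p, q, Polynomial.eval_finsetSum, mul_comm] using this
  have h1 := congrArg (fun r => Polynomial.coeff r 1) hpq
  have hq : q.coeff 1 = n * l x := by
    simp [q, Polynomial.coeff_one_add_X_pow]
  have hp : p.coeff 1 = l (∑ i, φ (Function.update (fun _ => c) i a)) := by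
    simp only [p, Polynomial.finsetSum_coeff, Polynomial.coeff_monomial]
    rw [← Finset.sum_filter, map_sum]
    -- Only singletons contribute to the coefficient of `t`.
    have : (Finset.univ.filter fun s : Finset (Fin n) => s.card = 1) =
        Finset.univ.map ⟨fun i : Fin n => {i}, Finset.singleton_injective⟩ := by
      ext s
      simp [Finset.card_eq_one, eq_comm]
    rw [this, Finset.sum_map]
    simp [Finset.piecewise_singleton]
  simp only [hp, hq] at h1
  simpa using h1

theorem update_eq_of_symmetric {φ : MultilinearMap ℂ (fun _ : Fin n => V) W}
    (hφ : ∀ (σ : Equiv.Perm (Fin n)) (x : Fin n → V), φ (fun i => x (σ i)) = φ x)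
    (a c : V) (i j : Fin n) :
    φ (Function.update (fun _ => c) i a) = φ (Function.update (fun _ => c) j a) := by
  rw [← hφ (Equiv.swap i j)]
  congr 1
  funext k
  by_cases hk : k = j
  · subst hk; simp
  · have : Equiv.swap i j k ≠ i := by
      rw [Ne, Equiv.swap_apply_eq_iff, Equiv.swap_apply_left]; exact hk
    simp [hk, this]

theorem update_eq_of_diagonal {φ : MultilinearMap ℂ (fun _ : Fin n => V) W}
    (hφ : ∀ (σ : Equiv.Perm (Fin n)) (x : Fin n → V), φ (fun i => x (σ i)) = φ x)
    (a c : V) (x y : W) (h : ∀ t : ℂ, φ (fun _ => c + t • a) = (1 + t) ^ n • x + y)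
    (i : Fin n) : φ (Function.update (fun _ => c) i a) = x := by
  have h1 := sum_update_eq_of_diagonal φ a c x y h
  rw [Finset.sum_congr rfl fun j _ => update_eq_of_symmetric hφ a c j i] at h1
  have hn : (n : ℂ) ≠ 0 := by
    have := i.pos
    exact_mod_cast this.ne'
  simp only [Finset.sum_const, Finset.card_univ, Fintype.card_fin, ← Nat.cast_smul_eq_nsmul ℂ] at h1
  exact smul_right_injective W hn h1

/-- Induction on `n`: the linear coefficient of the zero polynomial `t ↦ φ(c + t a, …, c + t a)`
shows that `φ(a, ·)`, which is again symmetric, vanishes on the diagonal. -/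
theorem eq_zero_of_symmetric_of_diagonal :
    ∀ {n : ℕ} (φ : MultilinearMap ℂ (fun _ : Fin n => V) W)
      (_ : ∀ (σ : Equiv.Perm (Fin n)) (x : Fin n → V), φ (fun i => x (σ i)) = φ x)
      (_ : ∀ x, φ (fun _ => x) = 0), φ = 0
  | 0, φ, _, h => by
    ext x
    rw [Subsingleton.elim x fun _ => 0, h]; rfl
  | n + 1, φ, hs, h => by
    have hz : ∀ a, φ.curryLeft a = 0 := by
      intro a
      apply eq_zero_of_symmetric_of_diagonal
      · intro σ x
        simp only [MultilinearMap.curryLeft_apply]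
        -- The permutation that fixes `0` and acts as `σ` on the remaining indices.
        rw [← hs (Equiv.Perm.decomposeFin.symm (0, σ)) (Fin.cons a x)]
        congr 1
        funext i
        refine Fin.cases ?_ (fun j => ?_) i <;> simp
      · intro c
        have := update_eq_of_diagonal hs a c 0 0 (by simp [h]) 0
        rw [MultilinearMap.curryLeft_apply, ← this]
        congr 1
        funext i
        refine Fin.cases ?_ (fun j => ?_) i <;> simp
    ext x
    rw [← Fin.cons_self_tail x, ← MultilinearMap.curryLeft_apply, hz]
    rfl

end PolynomialCurves

/-! ### Existence and uniqueness of the associated symmetric map. -/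

section Symmetrization

variable {E : Type u} {X : Type v} [AddCommGroup E] [Module ℂ E] [AddCommGroup X] [Module ℂ X]
  {n : ℕ}

theorem IsAssociatedSymmetric.unique {P : E → X}
    {φ ψ : MultilinearMap ℂ (fun _ : Fin n => E) X} (hφ : IsAssociatedSymmetric φ P)
    (hψ : IsAssociatedSymmetric ψ P) : φ = ψ := by
  rw [← sub_eq_zero]
  apply eq_zero_of_symmetric_of_diagonal
  · intro σ x
    simp [hφ.1, hψ.1]
  · intro x
    simp [← hφ.2, ← hψ.2]

theorem IsHomogeneousPolynomial.exists_isAssociatedSymmetric {P : E → X}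
    (hP : IsHomogeneousPolynomial n P) :
    ∃ φ : MultilinearMap ℂ (fun _ : Fin n => E) X, IsAssociatedSymmetric φ P := by
  obtain ⟨ψ, hψ⟩ := hP
  refine ⟨((n.factorial : ℂ)⁻¹) • ∑ σ : Equiv.Perm (Fin n), ψ.domDomCongr σ, ?_, ?_⟩
  · intro σ x
    simp only [smul_apply, sum_apply,
      MultilinearMap.domDomCongr_apply]
    congr 1
    exact Fintype.sum_equiv (Equiv.mulLeft σ) _ _ fun τ => rfl
  · intro x
    have : (n.factorial : ℂ) ≠ 0 := by exact_mod_cast n.factorial_ne_zero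
    simp [MultilinearMap.domDomCongr_apply, hψ, Fintype.card_perm,
      ← Nat.cast_smul_eq_nsmul ℂ, smul_smul, inv_mul_cancel₀ this]

theorem IsAssociatedSymmetric.map_smul {P : E → X}
    {φ : MultilinearMap ℂ (fun _ : Fin n => E) X} (hφ : IsAssociatedSymmetric φ P)
    (c : ℂ) (f : E) : P (c • f) = c ^ n • P f := by
  rw [hφ.2, hφ.2]
  simpa using φ.map_smul_univ (fun _ => c) fun _ => f

end Symmetrization

/-! ### Schur's lemma without finite-dimensionality. -/

section Schur

variable {G : Type u} [Group G] [TopologicalSpace G]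

theorem toHom_mul_apply (π : IrredUnitaryRep G) (s t : G) (x : π.H) :
    π.toHom (s * t) x = π.toHom s (π.toHom t x) := by
  rw [map_mul]; rfl

theorem toHom_apply_inv_self (π : IrredUnitaryRep G) (s : G) (x : π.H) :
    π.toHom s (π.toHom s⁻¹ x) = x := by
  rw [← toHom_mul_apply, mul_inv_cancel, map_one]; rfl

theorem inner_toHom_left (π : IrredUnitaryRep G) (s : G) (x y : π.H) :
    inner ℂ (π.toHom s x) y = inner ℂ x (π.toHom s⁻¹ y) := by
  rw [← LinearIsometryEquiv.inner_map_map (π.toHom s) x, toHom_apply_inv_self]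

theorem ker_eq_bot_or_top {E : Type*} [NormedAddCommGroup E] [NormedSpace ℂ E]
    (π : IrredUnitaryRep G) (S : π.H →L[ℂ] E)
    (h : ∀ t x, S x = 0 → S (π.toHom t x) = 0) : (∀ x, S x = 0 → x = 0) ∨ S = 0 := by
  rcases π.irreducible (LinearMap.ker S.toLinearMap) S.isClosed_ker
    (fun t w hw => h t w hw) with h | h
  · left
    intro x hx
    have : x ∈ LinearMap.ker S.toLinearMap := hx
    simpa [h] using this
  · right
    ext x
    have : x ∈ LinearMap.ker S.toLinearMap := by rw [h]; trivial
    exact this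

/-- Schur's lemma for self-adjoint operators. -/
theorem eq_algebraMap_of_commute (π : IrredUnitaryRep G) (T : π.H →L[ℂ] π.H)
    (hT : IsSelfAdjoint T) (hc : ∀ t x, T (π.toHom t x) = π.toHom t (T x)) :
    ∃ c : ℝ, T = algebraMap ℝ (π.H →L[ℂ] π.H) c := by
  have hcomm : ∀ (f : ℝ → ℝ) t x,
      cfc f T (π.toHom t x) = π.toHom t (cfc f T x) := by
    intro f t x
    let u : π.H →L[ℂ] π.H := (π.toHom t).toContinuousLinearEquiv.toContinuousLinearMap
    have hu : Commute T u := by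
      ext y
      exact hc t y
    have := (hu.cfc_real f).eq
    exact congrArg (fun S : π.H →L[ℂ] π.H => S x) this
  obtain ⟨c, hcs⟩ : (spectrum ℝ T).Nonempty := ContinuousFunctionalCalculus.spectrum_nonempty T hT
  refine ⟨c, CFC.eq_algebraMap_of_spectrum_subset_singleton T c ?_ hT⟩
  intro d hd
  by_contra hne
  -- The positive parts of `T - m` and `m - T` have product zero and commute with the
  -- representation. If the first is nonzero it is injective by irreducibility, which forces the
  -- second to vanish.
  have key : ∀ m : ℝ, cfc (fun x : ℝ => max 0 (x - m)) T = 0 ∨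
      cfc (fun x : ℝ => max 0 (m - x)) T = 0 := by
    intro m
    have hprod : cfc (fun x : ℝ => max 0 (x - m)) T * cfc (fun x : ℝ => max 0 (m - x)) T = 0 := by
      rw [← cfc_mul _ _ T (by fun_prop) (by fun_prop)]
      have : (fun x : ℝ => max 0 (x - m) * max 0 (m - x)) = fun _ => 0 := by
        funext x
        rcases le_total x m with h | h
        · rw [max_eq_left (by linarith), zero_mul]
        · rw [max_eq_left (b := m - x) (by linarith), mul_zero]
      rw [this, cfc_const_zero]
    rcases ker_eq_bot_or_top π (cfc (fun x : ℝ => max 0 (x - m)) T)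
      (fun t x hx => by rw [hcomm, hx, map_zero]) with h | h
    · right
      ext x
      exact h _ (congrArg (fun S : π.H →L[ℂ] π.H => S x) hprod)
    · exact Or.inl h
  have vanish : ∀ (f : ℝ → ℝ) (_ : Continuous f) (x : ℝ), x ∈ spectrum ℝ T →
      cfc f T = 0 → f x = 0 := by
    intro f hf x hx h0
    have := cfc_map_spectrum f T hT hf.continuousOn
    rw [h0, spectrum.zero_eq] at this
    have hx' : f x ∈ f '' spectrum ℝ T := ⟨x, hx, rfl⟩
    rw [← this] at hx'
    exact hx'
  -- With `m` the midpoint, either alternative puts `c` and `d` on the same side of it, so they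
  -- coincide.
  rcases key ((c + d) / 2) with h | h
  · have h1 := vanish _ (by fun_prop) c hcs h
    have h2 := vanish _ (by fun_prop) d hd h
    rw [max_eq_left_iff] at h1 h2
    exact hne (by rw [Set.mem_singleton_iff]; linarith)
  · have h1 := vanish _ (by fun_prop) c hcs h
    have h2 := vanish _ (by fun_prop) d hd h
    rw [max_eq_left_iff] at h1 h2
    exact hne (by rw [Set.mem_singleton_iff]; linarith)

/-- The operator `R* R` is self-adjoint and commutes with `π`, so it is a scalar `c ≥ 0`. If `c >
0`, then `R / √c` is an isometry whose range is closed, invariant and nonzero, hence everything. -/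
theorem eq_zero_or_equiv_of_intertwines (π ρ : IrredUnitaryRep G) (R : π.H →L[ℂ] ρ.H)
    (hR : ∀ t x, R (π.toHom t x) = ρ.toHom t (R x)) :
    R = 0 ∨ unitaryEquivalence G π ρ := by
  have hadj : ∀ t y, R.adjoint (ρ.toHom t y) = π.toHom t (R.adjoint y) := by
    intro t y
    refine ext_inner_right ℂ fun z => ?_
    rw [ContinuousLinearMap.adjoint_inner_left, inner_toHom_left, ← hR, inner_toHom_left,
      ContinuousLinearMap.adjoint_inner_left]
  obtain ⟨c, hc⟩ := eq_algebraMap_of_commute π (R.adjoint ∘L R)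
    (by rw [ContinuousLinearMap.isSelfAdjoint_iff', ContinuousLinearMap.adjoint_comp,
      ContinuousLinearMap.adjoint_adjoint]) (fun t x => by simp [hR, hadj])
  have hinner : ∀ x y, inner ℂ (R x) (R y) = (c : ℂ) * inner ℂ x y := by
    intro x y
    rw [← ContinuousLinearMap.adjoint_inner_right]
    have : R.adjoint (R y) = (c : ℂ) • y := by
      have := congrArg (fun S : π.H →L[ℂ] π.H => S y) hc
      simpa [Algebra.algebraMap_eq_smul_one] using this
    rw [this, inner_smul_right]
  have hnorm : ∀ x, ‖R x‖ ^ 2 = c * ‖x‖ ^ 2 := by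
    intro x
    have := hinner x x
    rw [inner_self_eq_norm_sq_to_K, inner_self_eq_norm_sq_to_K] at this
    exact Complex.ofReal_injective (by simpa using this)
  obtain ⟨x₀, hx₀⟩ := exists_ne (0 : π.H)
  have hx₀' : 0 < ‖x₀‖ ^ 2 := by positivity
  have hc0 : 0 ≤ c := by
    have := hnorm x₀
    by_contra hneg
    nlinarith [sq_nonneg ‖R x₀‖, mul_pos (neg_pos.mpr (not_le.mp hneg)) hx₀']
  rcases hc0.eq_or_lt with hc0 | hc0
  · left
    ext x
    have := hnorm x
    rw [← hc0, zero_mul] at this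
    simpa using this
  · right
    have hs : 0 < Real.sqrt c := Real.sqrt_pos.mpr hc0
    let V : π.H →ₗᵢ[ℂ] ρ.H :=
      { toLinearMap := ((Real.sqrt c)⁻¹ : ℂ) • R.toLinearMap
        norm_map' := fun x => by
          have h1 : ‖R x‖ = Real.sqrt c * ‖x‖ := by
            rw [← Real.sqrt_sq (norm_nonneg (R x)), hnorm, Real.sqrt_mul hc0.le,
              Real.sqrt_sq (norm_nonneg x)]
          change ‖((Real.sqrt c)⁻¹ : ℂ) • R x‖ = ‖x‖
          rw [norm_smul, h1, norm_inv, Complex.norm_real, Real.norm_of_nonneg hs.le,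
            inv_mul_cancel_left₀ hs.ne'] }
    have hV : ∀ t x, V (π.toHom t x) = ρ.toHom t (V x) := by
      intro t x
      change ((Real.sqrt c)⁻¹ : ℂ) • R _ = ρ.toHom t (((Real.sqrt c)⁻¹ : ℂ) • R x)
      rw [hR, map_smul]
    have hclosed : IsClosed (LinearMap.range V.toLinearMap : Set ρ.H) := by
      have := V.isometry.isClosedEmbedding.isClosed_range
      convert this
      ext; simp
    rcases ρ.irreducible _ hclosed (by
      rintro t _ ⟨x, rfl⟩
      exact ⟨π.toHom t x, hV t x⟩) with h | h
    · exfalso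
      have : V x₀ ∈ LinearMap.range V.toLinearMap := ⟨x₀, rfl⟩
      rw [h, Submodule.mem_bot] at this
      exact hx₀ (V.injective (by rw [this, map_zero]))
    · exact ⟨LinearIsometryEquiv.ofSurjective V (LinearMap.range_eq_top.mp h), hV⟩

/-- In finite dimension an eigenvalue exists, so self-adjointness is not needed. -/
theorem eq_smul_of_intertwines (π : IrredUnitaryRep G) [FiniteDimensional ℂ π.H]
    (R : π.H →L[ℂ] π.H) (hR : ∀ t x, R (π.toHom t x) = π.toHom t (R x)) :
    ∃ c : ℂ, ∀ x, R x = c • x := by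
  obtain ⟨c, hc⟩ := Module.End.exists_eigenvalue (K := ℂ) R.toLinearMap
  obtain ⟨v, hv, hv0⟩ := hc.exists_hasEigenvector
  rw [Module.End.mem_eigenspace_iff] at hv
  have hv : R v = c • v := hv
  refine ⟨c, fun x => ?_⟩
  rcases ker_eq_bot_or_top π (R - c • ContinuousLinearMap.id ℂ π.H) (fun t x hx => by
    simp only [sub_apply, smul_apply, ContinuousLinearMap.id_apply] at hx ⊢
    rw [hR, ← map_smul, ← map_sub, hx, map_zero]) with h | h
  · exact absurd (h v (by simp [hv])) hv0
  · have := congrArg (fun S : π.H →L[ℂ] π.H => S x) h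
    simpa [sub_eq_zero] using this

theorem continuous_inner_smul (π ρ : IrredUnitaryRep G) (x y : π.H) (w : ρ.H) :
    Continuous fun s : G => inner ℂ (π.toHom s x) y • ρ.toHom s w :=
  ((π.strongly_continuous x).inner continuous_const).smul (ρ.strongly_continuous w)

end Schur

/-! ### Averaged intertwiners, finite-dimensionality and Schur orthogonality. -/

section Orthogonality

variable {G : Type u} [Group G] [TopologicalSpace G] [IsTopologicalGroup G] [CompactSpace G]
  [MeasurableSpace G] [BorelSpace G]

/-- The intertwiner `y ↦ ∫ ⟨y | π(s) x⟩ ρ(s) w ds`. -/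
noncomputable def intertwiner (π ρ : IrredUnitaryRep G) (x : π.H) (w : ρ.H) :
    π.H →L[ℂ] ρ.H :=
  LinearMap.mkContinuous
    { toFun := fun y => ∫ s, inner ℂ (π.toHom s x) y • ρ.toHom s w ∂(haar G)
      map_add' := fun y z => by
        rw [← integral_add (integrable_of_continuous (continuous_inner_smul π ρ x y w))
          (integrable_of_continuous (continuous_inner_smul π ρ x z w))]
        simp only [inner_add_right, add_smul]
      map_smul' := fun c y => by
        rw [RingHom.id_apply, ← integral_smul]
        simp only [inner_smul_right, mul_smul] }
    (‖x‖ * ‖w‖) (fun y => by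
      have := norm_integral_le_of_norm_le_const (μ := haar G)
        (f := fun s => inner ℂ (π.toHom s x) y • ρ.toHom s w) (C := ‖x‖ * ‖w‖ * ‖y‖)
        (Filter.Eventually.of_forall fun s => by
          rw [norm_smul, LinearIsometryEquiv.norm_map]
          calc ‖inner ℂ (π.toHom s x) y‖ * ‖w‖ ≤ (‖π.toHom s x‖ * ‖y‖) * ‖w‖ := by
                gcongr; exact norm_inner_le_norm _ _
            _ = ‖x‖ * ‖w‖ * ‖y‖ := by rw [LinearIsometryEquiv.norm_map]; ring)
      simpa using this)

theorem intertwiner_apply (π ρ : IrredUnitaryRep G) (x : π.H) (w : ρ.H) (y : π.H) :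
    intertwiner π ρ x w y = ∫ s, inner ℂ (π.toHom s x) y • ρ.toHom s w ∂(haar G) := rfl

theorem inner_intertwiner (π ρ : IrredUnitaryRep G) (x : π.H) (w : ρ.H) (y : π.H) (z : ρ.H) :
    inner ℂ z (intertwiner π ρ x w y) =
      ∫ s, inner ℂ (π.toHom s x) y * inner ℂ z (ρ.toHom s w) ∂(haar G) := by
  rw [intertwiner_apply,
    ← integral_inner (integrable_of_continuous (continuous_inner_smul π ρ x y w))]
  simp only [inner_smul_right]

theorem intertwiner_intertwines (π ρ : IrredUnitaryRep G) (x : π.H) (w : ρ.H) (t : G) (y : π.H) :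
    intertwiner π ρ x w (π.toHom t y) = ρ.toHom t (intertwiner π ρ x w y) := by
  have h := (ρ.toHom t).toContinuousLinearEquiv.toContinuousLinearMap.integral_comp_comm
    (integrable_of_continuous (continuous_inner_smul π ρ x y w))
  simp only [intertwiner_apply]
  refine Eq.trans ?_ h
  -- Left invariance of Haar measure: substitute `t s` for `s`.
  rw [← integral_mul_left_eq_self _ t]
  congr 1
  funext s
  simp

/-- Its quadratic form at `x` is `∫ |⟨x | π(s) x⟩|² ds`, which is positive since the continuous
integrand is nonzero at the identity. -/
theorem intertwiner_self_ne_zero (π : IrredUnitaryRep G) {x : π.H} (hx : x ≠ 0) :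
    intertwiner π π x x ≠ 0 := by
  intro h
  have h1 : inner ℂ x (intertwiner π π x x x) = 0 := by simp [h]
  rw [inner_intertwiner] at h1
  have h2 : ∀ s, inner ℂ (π.toHom s x) x * inner ℂ x (π.toHom s x) =
      ((‖inner ℂ x (π.toHom s x)‖ ^ 2 : ℝ) : ℂ) := by
    intro s
    rw [← inner_conj_symm, RCLike.conj_mul]
    norm_cast
  simp only [h2] at h1
  rw [integral_complex_ofReal] at h1
  have hcont : Continuous fun s => ‖inner ℂ x (π.toHom s x)‖ ^ 2 :=
    ((continuous_const.inner (π.strongly_continuous x)).norm).pow 2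
  have := hcont.integral_pos_of_hasCompactSupport_nonneg_nonzero (μ := haar G)
    (HasCompactSupport.of_compactSpace _) (fun s => by positivity) (x := 1) (by simp [hx])
  exact this.ne' (by exact_mod_cast h1)

/-- A partial trace: it is bounded through Bessel's inequality to obtain finite dimension, and
evaluated on a full basis for the orthogonality relations. -/
theorem sum_inner_intertwiner (π : IrredUnitaryRep G) (x w : π.H) {ι : Type*} (s : Finset ι)
    (b : ι → π.H) :
    ∑ i ∈ s, inner ℂ (b i) (intertwiner π π x w (b i)) =
      ∫ t, ∑ i ∈ s, inner ℂ (π.toHom t x) (b i) * inner ℂ (b i) (π.toHom t w) ∂(haar G) := by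
  rw [integral_finsetSum]
  · simp only [inner_intertwiner]
  · intro i _
    exact integrable_of_continuous (((π.strongly_continuous x).inner continuous_const).mul
      (continuous_const.inner (π.strongly_continuous w)))

/-- The intertwiner of `x` with itself is a nonzero real scalar `c`. Its partial trace over `N`
orthonormal vectors is `N c`, which Bessel's inequality confines to `[0, ‖x‖²]`, so `N` is bounded.
-/
instance finiteDimensional (π : IrredUnitaryRep G) : FiniteDimensional ℂ π.H := by
  obtain ⟨x, hx⟩ := exists_ne (0 : π.H)
  obtain ⟨c, hc⟩ := eq_algebraMap_of_commute π (intertwiner π π x x)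
    (by
      rw [ContinuousLinearMap.isSelfAdjoint_iff_isSymmetric]
      intro y z
      change inner ℂ (intertwiner π π x x y) z = inner ℂ y (intertwiner π π x x z)
      rw [← inner_conj_symm, inner_intertwiner, inner_intertwiner, ← integral_conj]
      congr 1
      funext s
      rw [map_mul, inner_conj_symm, inner_conj_symm, mul_comm])
    (intertwiner_intertwines π π x x)
  have hc' : ∀ y, intertwiner π π x x y = (c : ℂ) • y := by
    intro y
    have := congrArg (fun S : π.H →L[ℂ] π.H => S y) hc
    simpa [Algebra.algebraMap_eq_smul_one] using this
  have hc0 : c ≠ 0 := by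
    rintro rfl
    exact intertwiner_self_ne_zero π hx (by ext y; simp [hc'])
  have bound : ∀ (N : ℕ) (b : Fin N → π.H), Orthonormal ℂ b → N * c ∈ Set.Icc 0 (‖x‖ ^ 2) := by
    intro N b hb
    have h := sum_inner_intertwiner π x x Finset.univ b
    have e : ∀ t, ∑ i, inner ℂ (π.toHom t x) (b i) * inner ℂ (b i) (π.toHom t x) =
        ((∑ i, ‖inner ℂ (b i) (π.toHom t x)‖ ^ 2 : ℝ) : ℂ) := by
      intro t
      push_cast
      refine Finset.sum_congr rfl fun i _ => ?_
      rw [← inner_conj_symm, RCLike.conj_mul]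
      norm_cast
    simp only [e, hc', inner_smul_right, inner_self_eq_norm_sq_to_K, hb.1] at h
    rw [integral_complex_ofReal] at h
    have h' : N * c = ∫ t, ∑ i, ‖inner ℂ (b i) (π.toHom t x)‖ ^ 2 ∂(haar G) := by
      have : ((N * c : ℝ) : ℂ) =
          ((∫ t, ∑ i, ‖inner ℂ (b i) (π.toHom t x)‖ ^ 2 ∂(haar G) : ℝ) : ℂ) := by
        rw [← h]; simp
      exact_mod_cast this
    rw [h']
    refine ⟨integral_nonneg fun t => by positivity, ?_⟩
    have hle : ∀ t, ∑ i, ‖inner ℂ (b i) (π.toHom t x)‖ ^ 2 ≤ ‖x‖ ^ 2 := fun t => by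
      have := hb.sum_inner_products_le (π.toHom t x) (s := Finset.univ)
      rwa [LinearIsometryEquiv.norm_map] at this
    have hcont : Continuous fun t => ∑ i, ‖inner ℂ (b i) (π.toHom t x)‖ ^ 2 :=
      continuous_finsetSum _ fun i _ =>
        ((continuous_const.inner (π.strongly_continuous x)).norm).pow 2
    calc _ ≤ ∫ _, ‖x‖ ^ 2 ∂(haar G) :=
          integral_mono (integrable_of_continuous hcont) (integrable_const _) hle
      _ = ‖x‖ ^ 2 := by simp
  by_contra hfin
  have hbasis : ∀ N : ℕ, ∃ b : Fin N → π.H, Orthonormal ℂ b := by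
    intro N
    have hr : (N : Cardinal) ≤ Module.rank ℂ π.H :=
      (Cardinal.natCast_lt_aleph0.le).trans
        (not_lt.mp fun h => hfin (Module.rank_lt_aleph0_iff.mp h))
    obtain ⟨s, hs, hli⟩ := le_rank_iff_exists_linearIndependent_finset.mp hr
    let e := (s.equivFinOfCardEq hs).symm
    exact ⟨_, InnerProductSpace.gramSchmidtNormed_orthonormal (hli.comp e e.injective)⟩
  have hcpos : 0 < c := by
    obtain ⟨b, hb⟩ := hbasis 1
    have := (bound 1 b hb).1
    exact lt_of_le_of_ne (by simpa using this) hc0.symm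
  obtain ⟨N, hN⟩ := exists_nat_gt (‖x‖ ^ 2 / c)
  obtain ⟨b, hb⟩ := hbasis N
  rw [div_lt_iff₀ hcpos] at hN
  exact absurd (bound N b hb).2 (not_le.mpr hN)

/-- The Schur orthogonality relations for a single representation. -/
theorem intertwiner_self (π : IrredUnitaryRep G) (x w y : π.H) :
    intertwiner π π x w y = ((dim π : ℂ)⁻¹ * inner ℂ x w) • y := by
  obtain ⟨c, hc⟩ := eq_smul_of_intertwines π _ (intertwiner_intertwines π π x w)
  -- The trace of the scalar is `d_π c`; by Parseval and unitarity the integrand is the constant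
  -- `⟨x, w⟩`.
  have h := sum_inner_intertwiner π x w Finset.univ (stdOrthonormalBasis ℂ π.H)
  simp only [OrthonormalBasis.sum_inner_mul_inner, LinearIsometryEquiv.inner_map_map, hc,
    inner_smul_right] at h
  have hd : (dim π : ℂ) ≠ 0 := by
    have : 0 < dim π := Module.finrank_pos
    exact_mod_cast this.ne'
  have h2 : (dim π : ℂ) * c = inner ℂ x w := by
    simpa [dim] using h
  rw [hc, ← h2, inv_mul_cancel_left₀ hd]

theorem intertwiner_eq_zero (π ρ : IrredUnitaryRep G) (h : ¬ unitaryEquivalence G π ρ)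
    (x : π.H) (w : ρ.H) : intertwiner π ρ x w = 0 :=
  (eq_zero_or_equiv_of_intertwines π ρ _ (intertwiner_intertwines π ρ x w)).resolve_right h

end Orthogonality

/-! ### The block structure of the convolution algebra. -/

section Algebra

variable {G : Type u} [Group G] [TopologicalSpace G]

/-- The function `t ↦ ⟨π(t) x | y⟩`, as an element of `𝒯(G)`. -/
noncomputable def matrixCoeff (π : IrredUnitaryRep G) (x y : π.H) : TrigPoly G :=
  ⟨coefficient π x y, coefficient_mem π x y⟩

theorem trigPoly_ext {f g : TrigPoly G} (h : ∀ t, f.1 t = g.1 t) : f = g :=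
  Subtype.ext (ContinuousMap.ext h)

theorem matrixCoeff_apply (π : IrredUnitaryRep G) (x y : π.H) (t : G) :
    (matrixCoeff π x y).1 t = inner ℂ y (π.toHom t x) := rfl

theorem matrixCoeff_smul_right (π : IrredUnitaryRep G) (c : ℂ) (x y : π.H) :
    matrixCoeff π x (c • y) = (starRingEnd ℂ) c • matrixCoeff π x y :=
  trigPoly_ext fun t => by
    change inner ℂ (c • y) _ = _ * inner ℂ y _
    rw [inner_smul_left]

theorem matrixCoeff_smul_left (π : IrredUnitaryRep G) (c : ℂ) (x y : π.H) :
    matrixCoeff π (c • x) y = c • matrixCoeff π x y :=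
  trigPoly_ext fun t => by
    change inner ℂ y _ = _ * inner ℂ y _
    rw [map_smul, inner_smul_right]

theorem character_eq_sum (π : IrredUnitaryRep G) {ι : Type*} [Fintype ι]
    (b : OrthonormalBasis ι ℂ π.H) : character π = ∑ i, matrixCoeff π (b i) (b i) := by
  refine trigPoly_ext fun t => ?_
  change charFun π t = _
  rw [charFun, LinearMap.trace_eq_sum_inner _ b]
  simp [matrixCoeff_apply]

variable [IsTopologicalGroup G] [CompactSpace G] [MeasurableSpace G] [BorelSpace G]

theorem conv_add_left (f g h : TrigPoly G) : conv (f + g) h = conv f h + conv g h :=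
  trigPoly_ext fun t => by
    change ∫ s, (f.1 s + g.1 s) * h.1 (s⁻¹ * t) ∂(haar G) = (conv f h).1 t + (conv g h).1 t
    rw [conv_apply, conv_apply, ← integral_add (integrable_of_continuous (by fun_prop))
      (integrable_of_continuous (by fun_prop))]
    simp only [add_mul]

theorem conv_smul_left (c : ℂ) (f g : TrigPoly G) : conv (c • f) g = c • conv f g :=
  trigPoly_ext fun t => by
    change ∫ s, (c * f.1 s) * g.1 (s⁻¹ * t) ∂(haar G) = c * (conv f g).1 t
    rw [conv_apply, ← integral_const_mul]
    simp only [mul_assoc]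

variable (G) in
/-- Convolution as a bilinear map. -/
noncomputable def convBilin : TrigPoly G →ₗ[ℂ] TrigPoly G →ₗ[ℂ] TrigPoly G :=
  LinearMap.mk₂ ℂ conv conv_add_left conv_smul_left
    (fun f g h => trigPoly_ext fun t => congrFun (convFun_add f.1 g.1 h.1) t)
    (fun c f g => trigPoly_ext fun t => congrFun (convFun_smul f.1 c g.1) t)

theorem convBilin_apply (f g : TrigPoly G) : convBilin G f g = conv f g := rfl

theorem conv_matrixCoeff (π ρ : IrredUnitaryRep G) (x y : π.H) (z w : ρ.H) :
    conv (matrixCoeff π x y) (matrixCoeff ρ z w) =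
      matrixCoeff ρ z (intertwiner π ρ x w y) := by
  refine trigPoly_ext fun t => ?_
  change convFun (coefficient π x y) (coefficient ρ z w) t = _
  rw [convFun_coefficient, matrixCoeff_apply, intertwiner_apply]
  simp only [coefficient, ContinuousMap.coe_mk, inner_conj_symm]

/-- Up to the factor `d_π`, the product rule of rank-one operators, with the order of multiplication
reversed. -/
theorem conv_matrixCoeff_self (π : IrredUnitaryRep G) (x y z w : π.H) :
    conv (matrixCoeff π x y) (matrixCoeff π z w) =
      ((dim π : ℂ)⁻¹ * inner ℂ w x) • matrixCoeff π z y := by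
  rw [conv_matrixCoeff, intertwiner_self, matrixCoeff_smul_right]
  simp

theorem conv_matrixCoeff_of_not_equiv (π ρ : IrredUnitaryRep G)
    (h : ¬ unitaryEquivalence G π ρ) (x y : π.H) (z w : ρ.H) :
    conv (matrixCoeff π x y) (matrixCoeff ρ z w) = 0 := by
  rw [conv_matrixCoeff, intertwiner_eq_zero π ρ h]
  exact trigPoly_ext fun t => by simp [matrixCoeff_apply]

theorem dim_ne_zero (π : IrredUnitaryRep G) : (dim π : ℂ) ≠ 0 := by
  have : 0 < dim π := Module.finrank_pos
  exact_mod_cast this.ne'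

theorem conv_matrixCoeff_character (π : IrredUnitaryRep G) (x y : π.H) :
    (dim π : ℂ) • conv (matrixCoeff π x y) (character π) = matrixCoeff π x y := by
  let b := stdOrthonormalBasis ℂ π.H
  rw [character_eq_sum π b, ← convBilin_apply, map_sum]
  simp only [convBilin_apply, conv_matrixCoeff_self, Finset.smul_sum, smul_smul, ← mul_assoc,
    mul_inv_cancel₀ (dim_ne_zero π), one_mul]
  refine trigPoly_ext fun t => ?_
  have h : ∀ z, inner ℂ y (π.toHom t z) = inner ℂ (π.toHom t⁻¹ y) z := fun z => by
    rw [inner_toHom_left, inv_inv]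
  simp only [AddSubmonoidClass.coe_finsetSum, Submodule.coe_smul, ContinuousMap.sum_apply,
    ContinuousMap.smul_apply, matrixCoeff_apply, smul_eq_mul, h]
  rw [← OrthonormalBasis.sum_inner_mul_inner b]
  exact Finset.sum_congr rfl fun i _ => mul_comm _ _

theorem conv_character_matrixCoeff (π : IrredUnitaryRep G) (x y : π.H) :
    (dim π : ℂ) • conv (character π) (matrixCoeff π x y) = matrixCoeff π x y := by
  let b := stdOrthonormalBasis ℂ π.H
  rw [character_eq_sum π b, ← convBilin_apply, map_sum, LinearMap.sum_apply]
  simp only [convBilin_apply, conv_matrixCoeff_self, Finset.smul_sum, smul_smul, ← mul_assoc,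
    mul_inv_cancel₀ (dim_ne_zero π), one_mul]
  refine trigPoly_ext fun t => ?_
  simp only [AddSubmonoidClass.coe_finsetSum, Submodule.coe_smul, ContinuousMap.sum_apply,
    ContinuousMap.smul_apply, matrixCoeff_apply, smul_eq_mul]
  rw [OrthonormalBasis.sum_inner_mul_inner b]

theorem conv_matrixCoeff_character_of_not_equiv (π ρ : IrredUnitaryRep G)
    (h : ¬ unitaryEquivalence G π ρ) (x y : π.H) :
    conv (matrixCoeff π x y) (character ρ) = 0 := by
  rw [character_eq_sum ρ (stdOrthonormalBasis ℂ ρ.H), ← convBilin_apply, map_sum]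
  exact Finset.sum_eq_zero fun i _ => conv_matrixCoeff_of_not_equiv π ρ h _ _ _ _

/-- The minimal projection `d_π ⟨π(·) x | x⟩` given by a unit vector `x`. -/
noncomputable def vectorProj (π : IrredUnitaryRep G) (x : π.H) : TrigPoly G :=
  (dim π : ℂ) • matrixCoeff π x x

theorem conv_vectorProj (π : IrredUnitaryRep G) (x y : π.H) :
    conv (vectorProj π x) (vectorProj π y) =
      (inner ℂ y x * dim π : ℂ) • matrixCoeff π y x := by
  rw [vectorProj, vectorProj, ← convBilin_apply]
  simp only [map_smul, LinearMap.smul_apply, convBilin_apply, conv_matrixCoeff_self, smul_smul]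
  congr 1
  field_simp [dim_ne_zero π]

theorem conv_vectorProj_self (π : IrredUnitaryRep G) {x : π.H} (hx : ‖x‖ = 1) :
    conv (vectorProj π x) (vectorProj π x) = vectorProj π x := by
  rw [conv_vectorProj, inner_self_eq_norm_sq_to_K, hx]
  simp [vectorProj]

theorem conv_vectorProj_of_orthogonal (π : IrredUnitaryRep G) {x y : π.H}
    (h : inner ℂ y x = 0) : conv (vectorProj π x) (vectorProj π y) = 0 := by
  rw [conv_vectorProj, h, zero_mul, zero_smul]

theorem conv_vectorProj_of_not_equiv (π ρ : IrredUnitaryRep G)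
    (h : ¬ unitaryEquivalence G π ρ) (x : π.H) (y : ρ.H) :
    conv (vectorProj π x) (vectorProj ρ y) = 0 := by
  rw [vectorProj, vectorProj, ← convBilin_apply]
  simp only [map_smul, LinearMap.smul_apply, convBilin_apply,
    conv_matrixCoeff_of_not_equiv π ρ h, smul_zero]

/-- The trigonometric polynomial `t ↦ d_π trace (π(t) T)`. -/
noncomputable def operatorPoly (π : IrredUnitaryRep G) : (π.H →ₗ[ℂ] π.H) →ₗ[ℂ] TrigPoly G where
  toFun T := (dim π : ℂ) • ∑ i, matrixCoeff π (T (stdOrthonormalBasis ℂ π.H i))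
    (stdOrthonormalBasis ℂ π.H i)
  map_add' S T := by
    rw [← smul_add, ← Finset.sum_add_distrib]
    congr 1
    refine Finset.sum_congr rfl fun i _ => trigPoly_ext fun t => ?_
    simp [matrixCoeff_apply]
  map_smul' c T := by
    rw [RingHom.id_apply, smul_comm c, Finset.smul_sum (r := c)]
    congr 1
    exact Finset.sum_congr rfl fun i _ => matrixCoeff_smul_left π c _ _

theorem operatorPoly_eq_sum (π : IrredUnitaryRep G) (T : π.H →ₗ[ℂ] π.H) {ι : Type*} [Fintype ι]
    (b : OrthonormalBasis ι ℂ π.H) :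
    operatorPoly π T = (dim π : ℂ) • ∑ i, matrixCoeff π (T (b i)) (b i) := by
  change (dim π : ℂ) • (_ : TrigPoly G) = _
  congr 1
  refine trigPoly_ext fun t => ?_
  let S := (π.toHom t).toLinearEquiv.toLinearMap ∘ₗ T
  have h1 := LinearMap.trace_eq_sum_inner S b
  rw [LinearMap.trace_eq_sum_inner S (stdOrthonormalBasis ℂ π.H)] at h1
  simpa [S, matrixCoeff_apply] using h1

theorem matrixCoeff_mem_range (π : IrredUnitaryRep G) (x y : π.H) :
    matrixCoeff π x y ∈ LinearMap.range (operatorPoly π) := by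
  let b := stdOrthonormalBasis ℂ π.H
  -- The rank-one operator `z ↦ ⟨z | y⟩ x`, divided by `d_π` to cancel the factor in `operatorPoly`.
  refine ⟨(dim π : ℂ)⁻¹ • (innerSL ℂ y).toLinearMap.smulRight x, ?_⟩
  rw [map_smul, operatorPoly_eq_sum π _ b, inv_smul_smul₀ (dim_ne_zero π)]
  refine trigPoly_ext fun t => ?_
  simp only [AddSubmonoidClass.coe_finsetSum, ContinuousMap.sum_apply, matrixCoeff_apply]
  rw [← OrthonormalBasis.sum_inner_mul_inner b]
  exact Finset.sum_congr rfl fun i _ => by simp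

/-- The spectral theorem: an orthonormal eigenbasis, with the eigenvalues as coefficients. -/
theorem operatorPoly_of_isSymmetric (π : IrredUnitaryRep G) {T : π.H →ₗ[ℂ] π.H}
    (hT : T.IsSymmetric) : ∃ (b : OrthonormalBasis (Fin (dim π)) ℂ π.H) (l : Fin (dim π) → ℂ),
      operatorPoly π T = ∑ i, l i • vectorProj π (b i) := by
  refine ⟨hT.eigenvectorBasis rfl, fun i => hT.eigenvalues rfl i, ?_⟩
  rw [operatorPoly_eq_sum π T (hT.eigenvectorBasis rfl), Finset.smul_sum]
  refine Finset.sum_congr rfl fun i _ => ?_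
  rw [vectorProj, smul_comm, hT.apply_eigenvectorBasis, matrixCoeff_smul_left]
  rfl

theorem exists_isSymmetric_decomposition {H : Type*} [NormedAddCommGroup H]
    [InnerProductSpace ℂ H] [FiniteDimensional ℂ H] (T : H →ₗ[ℂ] H) :
    ∃ A B : H →ₗ[ℂ] H, A.IsSymmetric ∧ B.IsSymmetric ∧ T = A + Complex.I • B :=
  ⟨realPart T, imaginaryPart T, (LinearMap.isSymmetric_iff_isSelfAdjoint _).mpr (realPart T).2,
    (LinearMap.isSymmetric_iff_isSelfAdjoint _).mpr (imaginaryPart T).2,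
    (realPart_add_I_smul_imaginaryPart T).symm⟩

end Algebra

/-! ### Decomposition of `𝒯(G)` over `Ĝ`. -/

section Dual

variable {G : Type u} [Group G] [TopologicalSpace G]

/-- A representative of a class in `Ĝ`. -/
noncomputable def UnitaryDual.rep (p : UnitaryDual G) : IrredUnitaryRep G :=
  Quotient.out (s := unitaryEquivalence G) p

theorem UnitaryDual.mk_rep (p : UnitaryDual G) :
    (Quotient.mk (unitaryEquivalence G) p.rep : UnitaryDual G) = p :=
  Quotient.out_eq (s := unitaryEquivalence G) p

theorem UnitaryDual.dim_rep (p : UnitaryDual G) : TrigPolynomials.dim p.rep = p.dim := by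
  conv_rhs => rw [← p.mk_rep]
  rfl

theorem UnitaryDual.character_rep (p : UnitaryDual G) :
    TrigPolynomials.character p.rep = p.character := by
  conv_rhs => rw [← p.mk_rep]
  rfl

theorem UnitaryDual.rep_equiv_rep {p q : UnitaryDual G}
    (h : unitaryEquivalence G p.rep q.rep) : p = q := by
  rw [← p.mk_rep, ← q.mk_rep]
  exact Quotient.sound h

theorem matrixCoeff_eq_of_equiv {π ρ : IrredUnitaryRep G} (h : unitaryEquivalence G π ρ)
    (x y : π.H) : ∃ z w : ρ.H, matrixCoeff π x y = matrixCoeff ρ z w := by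
  obtain ⟨U, hU⟩ := h
  refine ⟨U x, U y, trigPoly_ext fun t => ?_⟩
  rw [matrixCoeff_apply, matrixCoeff_apply, ← hU, LinearIsometryEquiv.inner_map_map]

variable [IsTopologicalGroup G] [CompactSpace G] [MeasurableSpace G] [BorelSpace G]

theorem exists_eq_sum_operatorPoly (f : TrigPoly G) :
    ∃ (F : Finset (UnitaryDual G)) (T : ∀ p : UnitaryDual G, p.rep.H →ₗ[ℂ] p.rep.H),
      f = ∑ p ∈ F, operatorPoly p.rep (T p) := by
  classical
  let M := DFinsupp.lsum ℂ (fun p : UnitaryDual G => operatorPoly p.rep)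
  have hle : TrigPoly G ≤ (LinearMap.range M).map (TrigPoly G).subtype := by
    refine iSup_le fun π => Submodule.span_le.mpr ?_
    rintro _ ⟨x, y, rfl⟩
    let p : UnitaryDual G := Quotient.mk (unitaryEquivalence G) π
    have hp : unitaryEquivalence G π p.rep :=
      Quotient.exact (s := unitaryEquivalence G) p.mk_rep.symm
    obtain ⟨z, w, h⟩ := matrixCoeff_eq_of_equiv hp x y
    obtain ⟨T, hT⟩ := matrixCoeff_mem_range p.rep z w
    refine ⟨matrixCoeff π x y, ⟨DFinsupp.single p T, ?_⟩, rfl⟩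
    rw [h, ← hT]
    exact DFinsupp.lsum_single ..
  obtain ⟨g, ⟨T, hT⟩, hg⟩ := hle f.2
  have hgf : g = f := Subtype.ext hg
  refine ⟨T.support, fun p => T p, ?_⟩
  rw [← hgf, ← hT]
  simp [M, DFinsupp.lsum_apply_apply, DFinsupp.sumAddHom_apply, DFinsupp.sum]

/-- Every family of Hermitian operators is simultaneously diagonal in a system of orthogonal
minimal projections. -/
theorem exists_diagonalization (F : Finset (UnitaryDual G))
    {A : ∀ p : UnitaryDual G, p.rep.H →ₗ[ℂ] p.rep.H} (hA : ∀ p, (A p).IsSymmetric) :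
    ∃ (ι : Type (u + 1)) (_ : Fintype ι) (e : ι → TrigPoly G) (l : ι → ℂ),
      (∀ i, ∃ (p : UnitaryDual G) (x : p.rep.H), ‖x‖ = 1 ∧ e i = vectorProj p.rep x) ∧
      (∀ i j, i ≠ j → conv (e i) (e j) = 0) ∧
      ∑ p ∈ F, operatorPoly p.rep (A p) = ∑ i, l i • e i := by
  choose b l h using fun p => operatorPoly_of_isSymmetric p.rep (hA p)
  refine ⟨Σ p : F, Fin (dim p.1.rep), inferInstance, fun i => vectorProj i.1.1.rep (b i.1.1 i.2),
    fun i => l i.1.1 i.2, fun i => ⟨i.1.1, _, (b i.1.1).orthonormal.1 i.2, rfl⟩, ?_, ?_⟩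
  · rintro ⟨p, i⟩ ⟨q, j⟩ hne
    by_cases hpq : p = q
    · subst hpq
      refine conv_vectorProj_of_orthogonal _ ((b p.1).orthonormal.2 ?_)
      rintro rfl
      exact hne rfl
    · exact conv_vectorProj_of_not_equiv _ _
        (fun he => hpq (Subtype.ext (UnitaryDual.rep_equiv_rep he))) _ _
  · rw [Fintype.sum_sigma, ← Finset.sum_coe_sort F]
    exact Finset.sum_congr rfl fun p _ => h p.1

/-- Minimal projections span: every operator is `A + i B` with `A`, `B` Hermitian, and Hermitian
operators diagonalize. -/
theorem linearMap_ext_of_vectorProj {X : Type v} [AddCommGroup X] [Module ℂ X]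
    {Φ Ψ : TrigPoly G →ₗ[ℂ] X}
    (h : ∀ (p : UnitaryDual G) (x : p.rep.H), ‖x‖ = 1 →
      Φ (vectorProj p.rep x) = Ψ (vectorProj p.rep x)) : Φ = Ψ := by
  have hsym : ∀ (p : UnitaryDual G) (A : p.rep.H →ₗ[ℂ] p.rep.H), A.IsSymmetric →
      Φ (operatorPoly p.rep A) = Ψ (operatorPoly p.rep A) := by
    intro p A hA
    obtain ⟨b, l, hb⟩ := operatorPoly_of_isSymmetric p.rep hA
    simp only [hb, map_sum, map_smul, h p _ (b.orthonormal.1 _)]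
  ext f
  obtain ⟨F, T, rfl⟩ := exists_eq_sum_operatorPoly f
  simp only [map_sum]
  refine Finset.sum_congr rfl fun p _ => ?_
  obtain ⟨A, B, hA, hB, hT⟩ := exists_isSymmetric_decomposition (T p)
  rw [hT]
  simp only [map_add, map_smul, hsym p A hA, hsym p B hB]

theorem conv_operatorPoly_character {p q : UnitaryDual G} (hpq : p ≠ q)
    (T : p.rep.H →ₗ[ℂ] p.rep.H) : conv (operatorPoly p.rep T) q.character = 0 := by
  rw [operatorPoly_eq_sum p.rep T (stdOrthonormalBasis ℂ p.rep.H), ← convBilin_apply, map_smul,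
    map_sum, LinearMap.smul_apply, LinearMap.sum_apply, ← q.character_rep]
  simp only [convBilin_apply]
  rw [Finset.sum_eq_zero, smul_zero]
  exact fun i _ => conv_matrixCoeff_character_of_not_equiv _ _
    (fun he => hpq (UnitaryDual.rep_equiv_rep he)) _ _

theorem finite_conv_character_ne_zero (f : TrigPoly G) :
    {p : UnitaryDual G | conv f p.character ≠ 0}.Finite := by
  obtain ⟨F, T, rfl⟩ := exists_eq_sum_operatorPoly f
  refine F.finite_toSet.subset fun q hq => ?_
  by_contra hqF
  refine hq ?_
  rw [← convBilin_apply, map_sum, LinearMap.sum_apply]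
  refine Finset.sum_eq_zero fun p hp => conv_operatorPoly_character ?_ _
  rintro rfl
  exact hqF hp

theorem conv_vectorProj_character_of_ne {p q : UnitaryDual G} (hpq : p ≠ q) (x : p.rep.H) :
    conv (vectorProj p.rep x) q.character = 0 := by
  rw [vectorProj, conv_smul_left, ← q.character_rep, conv_matrixCoeff_character_of_not_equiv _ _
    (fun he => hpq (UnitaryDual.rep_equiv_rep he)), smul_zero]

theorem conv_vectorProj_character (p : UnitaryDual G) (x : p.rep.H) :
    (p.dim : ℂ) • conv (vectorProj p.rep x) p.character = vectorProj p.rep x := by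
  rw [vectorProj, conv_smul_left, ← p.character_rep, smul_comm, ← p.dim_rep,
    conv_matrixCoeff_character]

theorem conv_character_vectorProj (p : UnitaryDual G) (x : p.rep.H) :
    (p.dim : ℂ) • conv p.character (vectorProj p.rep x) = vectorProj p.rep x := by
  rw [vectorProj, ← convBilin_apply, map_smul, convBilin_apply, ← p.character_rep, smul_comm,
    ← p.dim_rep, conv_character_matrixCoeff]

end Dual

/-! ### Construction and uniqueness of the representing linear map. -/

section Representation

variable {G : Type u} [Group G] [TopologicalSpace G] [IsTopologicalGroup G] [CompactSpace G]
  [MeasurableSpace G] [BorelSpace G] {X : Type v} [AddCommGroup X] {n : ℕ}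

theorem convPow_succ (f : TrigPoly G) (hn : n ≠ 0) :
    convPow f (n + 1) = conv (convPow f n) f := by
  obtain ⟨m, rfl⟩ := Nat.exists_eq_succ_of_ne_zero hn
  rfl

theorem conv_sum_sum {ι : Type*} [Fintype ι] {e : ι → TrigPoly G}
    (he : ∀ i, conv (e i) (e i) = e i) (hne : ∀ i j, i ≠ j → conv (e i) (e j) = 0)
    (a b : ι → ℂ) : conv (∑ i, a i • e i) (∑ i, b i • e i) = ∑ i, (a i * b i) • e i := by
  classical
  rw [← convBilin_apply, map_sum]
  refine Finset.sum_congr rfl fun i _ => ?_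
  rw [map_sum, LinearMap.sum_apply, Finset.sum_eq_single i]
  · simp only [map_smul, LinearMap.smul_apply, convBilin_apply, he, smul_smul, mul_comm]
  · intro j _ hj
    simp only [map_smul, LinearMap.smul_apply, convBilin_apply, hne j i hj, smul_zero]
  · simp

theorem convPow_sum {ι : Type*} [Fintype ι] {e : ι → TrigPoly G}
    (he : ∀ i, conv (e i) (e i) = e i) (hne : ∀ i j, i ≠ j → conv (e i) (e j) = 0)
    (a : ι → ℂ) (hn : n ≠ 0) : convPow (∑ i, a i • e i) n = ∑ i, a i ^ n • e i := by
  induction n, Nat.one_le_iff_ne_zero.mpr hn using Nat.le_induction with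
  | base => simp [convPow]
  | succ m hm ih =>
    rw [convPow_succ _ (by omega), ih (by omega), conv_sum_sum he hne]
    simp only [pow_succ]

theorem convPow_eq_self {e : TrigPoly G} (he : conv e e = e) (hn : n ≠ 0) : convPow e n = e := by
  induction n, Nat.one_le_iff_ne_zero.mpr hn using Nat.le_induction with
  | base => rfl
  | succ m hm ih => rw [convPow_succ _ (by omega), ih (by omega), he]

/-- Each further factor applies the bilinear convolution to two polynomial curves. -/
theorem convPow_mem_polyCurve (a b : TrigPoly G) :
    (fun t : ℂ => convPow (a + t • b) n) ∈ polyCurve (TrigPoly G) := by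
  induction n with
  | zero => simpa [convPow] using monomial_mem_polyCurve 0 (0 : TrigPoly G)
  | succ n ih =>
    rcases eq_or_ne n 0 with rfl | hn
    · exact affine_mem_polyCurve a b
    · simp only [convPow_succ _ hn]
      exact map₂_mem_polyCurve (convBilin G) ih (affine_mem_polyCurve a b)

theorem IsOrthogonallyAdditive.map_sum {P : TrigPoly G → X} (hP : IsOrthogonallyAdditive P)
    (h0 : P 0 = 0) {ι : Type*} (s : Finset ι) {g : ι → TrigPoly G}
    (hg : ∀ i j, i ≠ j → conv (g i) (g j) = 0) : P (∑ i ∈ s, g i) = ∑ i ∈ s, P (g i) := by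
  classical
  induction s using Finset.induction_on with
  | empty => simpa using h0
  | insert i s hi ih =>
    rw [Finset.sum_insert hi, Finset.sum_insert hi, hP, ih]
    · rw [← convBilin_apply, _root_.map_sum]
      exact Finset.sum_eq_zero fun j hj => hg i j (by rintro rfl; exact hi hj)
    · rw [← convBilin_apply, _root_.map_sum, LinearMap.sum_apply]
      exact Finset.sum_eq_zero fun j hj => hg j i (by rintro rfl; exact hi hj)

variable [Module ℂ X]

/-- For orthogonal `a` and `b`, the symmetric map associated with an orthogonally additive
polynomial satisfies `φ(a, a + b, …, a + b) = P(a)`. -/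
theorem IsOrthogonallyAdditive.update_add {P : TrigPoly G → X} (hP : IsOrthogonallyAdditive P)
    {φ : MultilinearMap ℂ (fun _ : Fin n => TrigPoly G) X} (hφ : IsAssociatedSymmetric φ P)
    {a b : TrigPoly G} (hab : conv a b = 0) (hba : conv b a = 0) (i : Fin n) :
    φ (Function.update (fun _ => a + b) i a) = P a := by
  -- Here `(a + b) + t a = (1 + t) a + b`, whose two terms are still orthogonal.
  refine update_eq_of_diagonal hφ.1 a (a + b) (P a) (P b) (fun t => ?_) i
  rw [← hφ.2, ← hφ.map_smul, ← hP]
  · congr 1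
    module
  · rw [conv_smul_left, hab, smul_zero]
  · rw [← convBilin_apply, _root_.map_smul, convBilin_apply, hba, smul_zero]

/-- The linear map `f ↦ φ(d_π f ∗ χ_π, d_π χ_π, …, d_π χ_π)`. -/
noncomputable def blockMap (φ : MultilinearMap ℂ (fun _ : Fin n => TrigPoly G) X) (i : Fin n)
    (p : UnitaryDual G) : TrigPoly G →ₗ[ℂ] X :=
  (p.dim : ℂ) • φ.toLinearMap (fun _ => (p.dim : ℂ) • p.character) i ∘ₗ
    (convBilin G).flip p.character

theorem blockMap_apply (φ : MultilinearMap ℂ (fun _ : Fin n => TrigPoly G) X) (i : Fin n)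
    (p : UnitaryDual G) (f : TrigPoly G) :
    blockMap φ i p f = φ (Function.update (fun _ => (p.dim : ℂ) • p.character) i
      ((p.dim : ℂ) • conv f p.character)) := by
  rw [φ.map_update_smul]
  rfl

theorem support_blockMap_subset (φ : MultilinearMap ℂ (fun _ : Fin n => TrigPoly G) X)
    (i : Fin n) (f : TrigPoly G) :
    (Function.support fun p => blockMap φ i p f) ⊆
      {p : UnitaryDual G | conv f p.character ≠ 0} := by
  intro p hp h
  refine hp ?_
  change blockMap φ i p f = 0
  rw [blockMap_apply, h, smul_zero, φ.map_update_zero]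

/-- The linear map `f ↦ ∑ φ(d_π f ∗ χ_π, d_π χ_π, …, d_π χ_π)`. -/
noncomputable def representingMap (φ : MultilinearMap ℂ (fun _ : Fin n => TrigPoly G) X)
    (i : Fin n) : TrigPoly G →ₗ[ℂ] X where
  toFun f := ∑ᶠ p : UnitaryDual G, blockMap φ i p f
  map_add' f g := by
    simp only [map_add]
    -- Additivity of `∑ᶠ` requires finite supports, since the sum is zero by default otherwise.
    exact finsum_add_distrib
      ((finite_conv_character_ne_zero f).subset (support_blockMap_subset φ i f))
      ((finite_conv_character_ne_zero g).subset (support_blockMap_subset φ i g))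
  map_smul' c f := by
    simp only [map_smul, RingHom.id_apply]
    exact (smul_finsum c _).symm

theorem representingMap_apply (φ : MultilinearMap ℂ (fun _ : Fin n => TrigPoly G) X)
    (i : Fin n) (f : TrigPoly G) :
    representingMap φ i f = ∑ᶠ p : UnitaryDual G, blockMap φ i p f := rfl

variable {P : TrigPoly G → X} {φ : MultilinearMap ℂ (fun _ : Fin n => TrigPoly G) X}

/-- Only the block of `p` contributes. There the identity `d_π χ_π` splits as the projection plus
its orthogonal complement, so `update_add` applies. -/
theorem representingMap_vectorProj (hP : IsOrthogonallyAdditive P)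
    (hφ : IsAssociatedSymmetric φ P) (i : Fin n) (p : UnitaryDual G) {x : p.rep.H}
    (hx : ‖x‖ = 1) : representingMap φ i (vectorProj p.rep x) = P (vectorProj p.rep x) := by
  rw [representingMap_apply, finsum_eq_single _ p, blockMap_apply, conv_vectorProj_character]
  · have h := hP.update_add hφ (a := vectorProj p.rep x)
      (b := (p.dim : ℂ) • p.character - vectorProj p.rep x)
      (by rw [← convBilin_apply, map_sub, map_smul, convBilin_apply, convBilin_apply,
        conv_vectorProj_character, conv_vectorProj_self _ hx, sub_self])
      (by rw [← convBilin_apply, map_sub, map_smul, LinearMap.sub_apply, LinearMap.smul_apply,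
        convBilin_apply, convBilin_apply, conv_character_vectorProj, conv_vectorProj_self _ hx, sub_self]) i
    rwa [add_sub_cancel] at h
  · intro q hq
    rw [blockMap_apply, conv_vectorProj_character_of_ne hq.symm, smul_zero, φ.map_update_zero]

theorem eq_representingMap_convPow (hP : IsOrthogonallyAdditive P)
    (hφ : IsAssociatedSymmetric φ P) (i : Fin n) (f : TrigPoly G) :
    P f = representingMap φ i (convPow f n) := by
  have hn : n ≠ 0 := i.pos.ne'
  have h0 : P 0 = 0 := by simpa [hn] using hφ.map_smul 0 0
  obtain ⟨F, T, rfl⟩ := exists_eq_sum_operatorPoly f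
  choose A B hA hB hT using fun p => exists_isSymmetric_decomposition (T p)
  let a := ∑ p ∈ F, operatorPoly p.rep (A p)
  let b := ∑ p ∈ F, operatorPoly p.rep (B p)
  -- The defect of the identity along the line through `a` in direction `b`. For real `t` the point
  -- `a + t b` is Hermitian; `f` itself is the point `t = i`.
  have hcurve : (fun t : ℂ => φ (fun _ => a + t • b) - representingMap φ i
      (convPow (a + t • b) n)) ∈ polyCurve X :=
    (polyCurve X).sub_mem (diagonal_mem_polyCurve φ b a)
      (map_mem_polyCurve _ (convPow_mem_polyCurve a b))
  have hreal : ∀ t : ℝ, φ (fun _ => a + (t : ℂ) • b) - representingMap φ i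
      (convPow (a + (t : ℂ) • b) n) = 0 := by
    intro t
    have hsum : a + (t : ℂ) • b = ∑ p ∈ F, operatorPoly p.rep (A p + (t : ℂ) • B p) := by
      simp only [a, b, map_add, map_smul, Finset.sum_add_distrib, Finset.smul_sum]
    obtain ⟨ι, _, e, l, he, hne, hsum'⟩ := exists_diagonalization F
      (A := fun p => A p + (t : ℂ) • B p)
      (fun p => (hA p).add ((hB p).smul (Complex.conj_ofReal t)))
    have hidem : ∀ j, conv (e j) (e j) = e j := by
      intro j
      obtain ⟨p, x, hx, hj⟩ := he j
      rw [hj, conv_vectorProj_self _ hx]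
    rw [← hφ.2, hsum, hsum', convPow_sum hidem hne l hn, hP.map_sum h0, map_sum, sub_eq_zero]
    · refine Finset.sum_congr rfl fun j _ => ?_
      obtain ⟨p, x, hx, hj⟩ := he j
      rw [hφ.map_smul, map_smul, hj, representingMap_vectorProj hP hφ i p hx]
    · intro j k hjk
      rw [conv_smul_left, ← convBilin_apply, map_smul, convBilin_apply, hne j k hjk, smul_zero,
        smul_zero]
  have hI := polyCurve_eq_zero_of_real hcurve hreal Complex.I
  have hf : ∑ p ∈ F, operatorPoly p.rep (T p) = a + Complex.I • b := by
    simp only [a, b, hT, map_add, map_smul, Finset.sum_add_distrib, Finset.smul_sum]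
  rw [hf, hφ.2]
  exact sub_eq_zero.mp hI

/-- A minimal projection equals its own `n`-th convolution power, so the identity forces the value
of `Φ` there. -/
theorem eq_representingMap (hP : IsOrthogonallyAdditive P) (hφ : IsAssociatedSymmetric φ P)
    (i : Fin n) {Φ : TrigPoly G →ₗ[ℂ] X} (hΦ : ∀ f, P f = Φ (convPow f n)) :
    Φ = representingMap φ i := by
  refine linearMap_ext_of_vectorProj fun p x hx => ?_
  rw [representingMap_vectorProj hP hφ i p hx, hΦ,
    convPow_eq_self (conv_vectorProj_self _ hx) i.pos.ne']

end Representation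

end TrigPolynomials

theorem theorem2p3 {G : Type u} [Group G] [TopologicalSpace G] [IsTopologicalGroup G]
    [CompactSpace G] [MeasurableSpace G] [BorelSpace G]
    {X : Type v} [AddCommGroup X] [Module ℂ X] (n : ℕ) (hn : 2 ≤ n)
    (P : TrigPolynomials.TrigPoly G → X)
    (hP : TrigPolynomials.IsHomogeneousPolynomial n P)
    (hPadd : TrigPolynomials.IsOrthogonallyAdditive P) :
    (∃! Φ : TrigPolynomials.TrigPoly G →ₗ[ℂ] X,
      ∀ f, P f = Φ (TrigPolynomials.convPow f n)) ∧
    (∀ f : TrigPolynomials.TrigPoly G,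
      {π : TrigPolynomials.UnitaryDual G |
        TrigPolynomials.conv f π.character ≠ 0}.Finite) ∧
    (∃! φ : MultilinearMap ℂ (fun _ : Fin n => TrigPolynomials.TrigPoly G) X,
      TrigPolynomials.IsAssociatedSymmetric φ P) ∧
    (∀ Φ : TrigPolynomials.TrigPoly G →ₗ[ℂ] X,
      (∀ f, P f = Φ (TrigPolynomials.convPow f n)) →
      ∀ φ : MultilinearMap ℂ (fun _ : Fin n => TrigPolynomials.TrigPoly G) X,
        TrigPolynomials.IsAssociatedSymmetric φ P →
        ∀ f : TrigPolynomials.TrigPoly G,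
          Φ f = ∑ᶠ π : TrigPolynomials.UnitaryDual G,
            φ fun i : Fin n =>
              if (i : ℕ) = 0 then (π.dim : ℂ) • TrigPolynomials.conv f π.character
              else (π.dim : ℂ) • π.character) := by
  obtain ⟨φ₀, hφ₀⟩ := hP.exists_isAssociatedSymmetric
  let i₀ : Fin n := ⟨0, by omega⟩
  refine ⟨⟨TrigPolynomials.representingMap φ₀ i₀,
    TrigPolynomials.eq_representingMap_convPow hPadd hφ₀ i₀,
    fun Φ hΦ => TrigPolynomials.eq_representingMap hPadd hφ₀ i₀ hΦ⟩,
    TrigPolynomials.finite_conv_character_ne_zero,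
    ⟨φ₀, hφ₀, fun φ hφ => hφ.unique hφ₀⟩, ?_⟩
  intro Φ hΦ φ hφ f
  rw [TrigPolynomials.eq_representingMap hPadd hφ i₀ hΦ,
    TrigPolynomials.representingMap_apply]
  refine finsum_congr fun p => ?_
  rw [TrigPolynomials.blockMap_apply]
  congr 1
  funext i
  by_cases hi : (i : ℕ) = 0
  · have : i = i₀ := Fin.ext hi
    simp [this, i₀]
  · have : i ≠ i₀ := fun h => hi (congrArg Fin.val h)
    simp [this, hi]
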